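/- For a partition $\lambda$ (of any size, the empty partition included), the hook length of a box of its Young diagram is the number of boxes strictly to its right in its row, plus the number of boxes strictly below it in its column, plus one. For a positive integer $t$, $\lambda$ is a $t$-core if no box of its Young diagram has hook length $t$; it is a $(t_1,\dots,t_m)$-core if it is a $t_j$-core for every $j$; it is self-conjugate if its Young diagram is invariant under reflection along the main diagonal. Let $s$ and $d$ be relatively prime positive integers. Then there are only finitely many self-conjugate $(s,s+d,s+2d,s+3d)$-core partitions, and their number is \[ \sum_{i=0}^{\lfloor s/4\rfloor}\binom{\frac{s+d-1}{2}-i}{\frac{s-1}{2}-2i}\binom{\frac{s+d-1}{2}-i}{i} \qquad\text{if $d$ is even,} \] \[ \sum_{i=0}^{\lfloor s/2\rfloor}\binom{\lfloor\frac{s+d-1}{2}\rfloor-\lfloor\frac{i}{2}\rfloor}{\lfloor\frac{s}{2}\rfloor-i}\binom{\lfloor\frac{s+d}{2}\rfloor-\lfloor\frac{i+1}{2}\rfloor}{\lfloor\frac{i}{2}\rfloor} \qquad\text{if $d$ is odd.} \] -/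

import Mathlib

/-- The hook length of the box `c = (i, j)` (row `i`, column `j`, counted from `0`) of a Young
diagram: the boxes strictly to the right of `c` in its row, plus the boxes strictly below `c` in its
column, plus `c` itself. (Used only for boxes of `μ`, where no subtraction truncates.) -/
def YoungDiagram.hookLength (μ : YoungDiagram) (c : ℕ × ℕ) : ℕ :=
  (μ.rowLen c.1 - c.2 - 1) + (μ.colLen c.2 - c.1 - 1) + 1

/-- A partition, given by its Young diagram, is a `t`-core if no box has hook length `t`. -/
def YoungDiagram.IsCore (μ : YoungDiagram) (t : ℕ) : Prop :=
  ∀ c ∈ μ, μ.hookLength c ≠ t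

/-- A partition is self-conjugate if its Young diagram equals its reflection along the main
diagonal. -/
def YoungDiagram.IsSelfConjugate (μ : YoungDiagram) : Prop :=
  μ.transpose = μ

/-- The set of self-conjugate `(s, s + d, …, s + p d)`-core partitions (of any size, the empty
partition included). -/
def selfConjugateCores (s d p : ℕ) : Set YoungDiagram :=
  {μ | μ.IsSelfConjugate ∧ ∀ k ≤ p, μ.IsCore (s + k * d)}

/-! Encode a partition by the set `S` of its numbers `rowLen i - i - 1`. Being a `t`-core means that
`S` is closed under subtracting `t` (`isCore_iff_maya`), and self-conjugacy means that `x ↦ -1 - x`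
exchanges `S` with its complement (`isSelfConjugate_iff_maya`).

Put `N = s + d` and write integers as `x₀ + j d + i N`. Subtracting `s + k d` sends `(j, i)` to `(j
+ 1 - k, i - 1)`, so `S` is the region below a height function `h`. The cases `k = 0, 2` bound the
steps of `h` by 1, and `k = 3` forbids two consecutive up-steps. The ambiguity of coordinates gives
`h (j + N) = h j - d`, and for suitable `x₀` the antisymmetry of `S` becomes that of `h`
(`bijOn_belowHeight`).

Periodicity and symmetry leave only the first `M + 1` steps free, where `N = 2 M + 1 + ε`
(`bijOn_stepWord`). These words are counted by arranging the letters other than up-steps and then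
placing the up-steps in distinct gaps (`encard_stepLists`), summed over the number of up-steps and
the last letter. -/

/-! ### Maya sets of Young diagrams -/

namespace YoungDiagram

/-- The set of first-column beta numbers of a Young diagram, extended to all rows and shifted so
that the empty diagram gives the negative integers. -/
def maya (μ : YoungDiagram) : Set ℤ :=
  Set.range fun i : ℕ => (μ.rowLen i : ℤ) - i - 1

/-- Follow the diagonal of content `x` to its first cell outside `μ`: the boundary leaves that point
through the end of a column or of a row. -/
theorem mem_or_mem_colBeta (μ : YoungDiagram) (x : ℤ) :
    x ∈ μ.maya ∨ ∃ j : ℕ, x = j - (μ.colLen j : ℤ) := by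
  classical
  obtain ⟨a, b, hab, h0⟩ : ∃ a b : ℕ, x = b - a ∧ (a = 0 ∨ b = 0) := by
    rcases le_total 0 x with h | h
    · exact ⟨0, x.toNat, by omega, Or.inl rfl⟩
    · exact ⟨(-x).toNat, 0, by omega, Or.inr rfl⟩
  have hex : ∃ k : ℕ, (k + a, k + b) ∉ μ := by
    refine ⟨μ.rowLen 0, ?_⟩
    rw [mem_iff_lt_rowLen]
    have := μ.rowLen_anti 0 (μ.rowLen 0 + a) (Nat.zero_le _)
    omega
  obtain ⟨hk, hmin⟩ := (Nat.find_eq_iff hex).1 rfl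
  generalize Nat.find hex = k at hk hmin
  have hcol : μ.colLen (k + b) ≤ k + a := by
    rw [mem_iff_lt_colLen] at hk; omega
  by_cases hc : μ.colLen (k + b) = k + a
  · right
    exact ⟨k + b, by rw [hc]; push_cast; omega⟩
  left
  have hpos : 0 < k + a := by omega
  have hnot : (k + a - 1, k + b) ∉ μ := by
    rw [mem_iff_lt_colLen]; omega
  refine ⟨k + a - 1, ?_⟩
  have hle : μ.rowLen (k + a - 1) ≤ k + b := by
    rw [mem_iff_lt_rowLen] at hnot; omega
  have hge : k + b ≤ μ.rowLen (k + a - 1) := by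
    rcases Nat.eq_zero_or_pos k with rfl | hkpos
    · omega
    · have := hmin (k - 1) (by omega)
      rw [not_not, mem_iff_lt_rowLen] at this
      have e : k - 1 + a = k + a - 1 := by omega
      rw [e] at this
      omega
  have : μ.rowLen (k + a - 1) = k + b := le_antisymm hle hge
  simp only [this]
  omega

/-- Left minus right is the hook length of `(i, j)` if that is a box, and is negative otherwise. -/
theorem rowBeta_ne_colBeta (μ : YoungDiagram) (i j : ℕ) :
    (μ.rowLen i : ℤ) - i - 1 ≠ j - (μ.colLen j : ℤ) := by
  have h1 := mem_iff_lt_rowLen (μ := μ) (i := i) (j := j)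
  have h2 := mem_iff_lt_colLen (μ := μ) (i := i) (j := j)
  rw [h1] at h2
  omega

theorem notMem_maya_iff (μ : YoungDiagram) (x : ℤ) :
    x ∉ μ.maya ↔ ∃ j : ℕ, x = j - (μ.colLen j : ℤ) := by
  constructor
  · intro h
    exact (μ.mem_or_mem_colBeta x).resolve_left h
  · rintro ⟨j, rfl⟩ ⟨i, hi⟩
    exact μ.rowBeta_ne_colBeta i j hi

theorem isCore_iff_maya (μ : YoungDiagram) {t : ℕ} (ht : 0 < t) :
    μ.IsCore t ↔ ∀ x ∈ μ.maya, x - t ∈ μ.maya := by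
  constructor
  · rintro h _ ⟨i, rfl⟩
    by_contra hx
    obtain ⟨j, hj⟩ := (μ.notMem_maya_iff _).1 hx
    have h1 := mem_iff_lt_rowLen (μ := μ) (i := i) (j := j)
    have h2 := mem_iff_lt_colLen (μ := μ) (i := i) (j := j)
    have hm : (i, j) ∈ μ := by
      by_contra hm
      have h1' := mt h1.2 hm
      have h2' := mt h2.2 hm
      dsimp only at hj
      omega
    have h1' := h1.1 hm
    have h2' := h2.1 hm
    refine h _ hm ?_
    simp only [hookLength]
    dsimp only at hj
    omega
  · rintro h ⟨i, j⟩ hm hhook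
    have h1 := mem_iff_lt_rowLen.1 hm
    have h2 := mem_iff_lt_colLen.1 hm
    simp only [hookLength] at hhook
    refine (μ.notMem_maya_iff _).2 ⟨j, ?_⟩ (h _ ⟨i, rfl⟩)
    dsimp only
    omega

/-- The negated elements, listed by row, increase strictly, so their range determines the sequence.
-/
theorem maya_injective : Function.Injective maya := by
  intro μ ν h
  have hmono : ∀ κ : YoungDiagram, StrictMono fun i : ℕ => (i : ℤ) + 1 - κ.rowLen i := by
    intro κ i j hij
    have := κ.rowLen_anti i j hij.le
    dsimp only
    omega
  have hr : ∀ κ : YoungDiagram,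
      Set.range (fun i : ℕ => (i : ℤ) + 1 - κ.rowLen i) = Neg.neg '' κ.maya := by
    intro κ
    rw [maya, ← Set.range_comp]
    congr 1
    funext i
    simp only [Function.comp]
    ring
  have key := ((hmono μ).range_inj (hmono ν)).1 (by rw [hr, hr, h])
  ext ⟨i, j⟩
  rw [mem_cells, mem_cells, mem_iff_lt_rowLen, mem_iff_lt_rowLen]
  have := congrFun key i
  omega

theorem maya_transpose (μ : YoungDiagram) (x : ℤ) : x ∈ μ.transpose.maya ↔ -1 - x ∉ μ.maya := by
  rw [notMem_maya_iff]
  simp only [maya, Set.mem_range, rowLen_transpose]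
  refine exists_congr fun j => ?_
  omega

theorem isSelfConjugate_iff_maya (μ : YoungDiagram) :
    μ.IsSelfConjugate ↔ ∀ x, x ∈ μ.maya ↔ -1 - x ∉ μ.maya := by
  rw [IsSelfConjugate]
  constructor
  · intro h x
    rw [← maya_transpose, h]
  · intro h
    apply maya_injective
    ext x
    rw [maya_transpose, h]
    simp

end YoungDiagram

/-! ### Diagrams from antisymmetric sets -/

section OfAntisymmetric

variable {S : Set ℤ}

theorem ncard_inter_Ici_succ (hb : BddAbove S) (x : ℤ) [Decidable (x ∈ S)] :
    (S ∩ Set.Ici x).ncard = (S ∩ Set.Ici (x + 1)).ncard + if x ∈ S then 1 else 0 := by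
  have hfin : (S ∩ Set.Ici (x + 1)).Finite := by
    obtain ⟨B, hB⟩ := hb
    exact (Set.finite_Icc (x + 1) B).subset fun y hy => ⟨hy.2, hB hy.1⟩
  split_ifs with hx
  · rw [← Set.ncard_insert_of_notMem (a := x) (by simp) hfin]
    congr 1
    ext y
    simp only [Set.mem_inter_iff, Set.mem_Ici, Set.mem_insert_iff]
    constructor
    · rintro ⟨h1, h2⟩
      by_cases h : y = x
      · exact Or.inl h
      · exact Or.inr ⟨h1, by omega⟩
    · rintro (rfl | ⟨h1, h2⟩)
      · exact ⟨hx, le_refl _⟩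
      · exact ⟨h1, by omega⟩
  · rw [add_zero]
    congr 1
    ext y
    simp only [Set.mem_inter_iff, Set.mem_Ici]
    refine and_congr_right fun h1 => ⟨fun h2 => ?_, fun h2 => by omega⟩
    have : y ≠ x := by rintro rfl; exact hx h1
    omega

/-- The two sides agree at 0, and their difference does not change from `x` to `x + 1` because
exactly one of `x` and `-1 - x` lies in `S`. -/
theorem ncard_inter_Ici_neg (hb : BddAbove S) (hS : ∀ x, x ∈ S ↔ -1 - x ∉ S) (x : ℤ) :
    ((S ∩ Set.Ici (-x)).ncard : ℤ) = (S ∩ Set.Ici x).ncard + x := by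
  classical
  have step : ∀ x : ℤ, ((S ∩ Set.Ici (-x)).ncard : ℤ) - (S ∩ Set.Ici x).ncard - x =
      ((S ∩ Set.Ici (-(x + 1))).ncard : ℤ) - (S ∩ Set.Ici (x + 1)).ncard - (x + 1) := by
    intro x
    have h1 := ncard_inter_Ici_succ hb x
    have h2 := ncard_inter_Ici_succ hb (-(x + 1))
    have e : -(x + 1) + 1 = -x := by ring
    have e' : -1 - x = -(x + 1) := by ring
    have h3 := hS x
    rw [e'] at h3
    rw [e] at h2
    split_ifs at h1 h2 <;> first | omega | tauto
  induction x using Int.induction_on with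
  | zero => simp
  | succ i ih => have := step i; omega
  | pred i ih =>
    have := step (-(i : ℤ) - 1)
    have e : -(i : ℤ) - 1 + 1 = -i := by ring
    rw [e] at this
    omega

theorem ncard_inter_Ici_anti (hb : BddAbove S) {x y : ℤ} (h : x ≤ y) :
    (S ∩ Set.Ici y).ncard ≤ (S ∩ Set.Ici x).ncard := by
  apply Set.ncard_le_ncard
  · exact Set.inter_subset_inter_right _ (Set.Ici_subset_Ici.2 h)
  · obtain ⟨B, hB⟩ := hb
    exact (Set.finite_Icc x B).subset fun y hy => ⟨hy.2, hB hy.1⟩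

theorem ncard_inter_Ici_le_add (hb : BddAbove S) (x : ℤ) (k : ℕ) :
    (S ∩ Set.Ici x).ncard ≤ (S ∩ Set.Ici (x + k)).ncard + k := by
  classical
  induction k with
  | zero => simp
  | succ k ih =>
    have := ncard_inter_Ici_succ hb (x + k)
    rw [Nat.cast_succ, ← add_assoc x]
    split_ifs at this <;> omega

/-- The Young diagram whose boundary is described by the set `S`. -/
noncomputable def diagramOfMaya (hb : BddAbove S) (hS : ∀ x, x ∈ S ↔ -1 - x ∉ S) :
    YoungDiagram where
  -- Row `i` should come from the element of `S` with `i` larger ones; it reaches past column `j`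
  -- exactly when that element is at least `j - i`.
  cells := Set.Finite.toFinset (s := {c : ℕ × ℕ | c.1 < (S ∩ Set.Ici ((c.2 : ℤ) - c.1)).ncard}) <| by
    obtain ⟨B, hB⟩ := hb
    set n := (S ∩ Set.Ici 0).ncard
    refine ((Set.finite_Iio (n + B.toNat + 1)).prod (Set.finite_Iio (n + B.toNat + 1))).subset ?_
    rintro ⟨i, j⟩ hc
    simp only [Set.mem_ofPred_eq] at hc
    have hneg := ncard_inter_Ici_neg ⟨B, hB⟩ hS ((j : ℤ) - i)
    have hmain : ∀ x : ℤ, B < x → (S ∩ Set.Ici x).ncard = 0 := by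
      intro x hx
      rw [show S ∩ Set.Ici x = ∅ from ?_, Set.ncard_empty]
      ext y
      simp only [Set.mem_inter_iff, Set.mem_Ici, Set.mem_empty_iff_false, iff_false, not_and]
      intro hy
      have := hB hy
      omega
    simp only [Set.mem_prod, Set.mem_Iio]
    rcases le_total 0 ((j : ℤ) - i) with h | h
    · have h1 := ncard_inter_Ici_anti ⟨B, hB⟩ h
      have h2 : (j : ℤ) - i ≤ B := by
        by_contra h2
        have := hmain _ (not_le.1 h2)
        omega
      omega
    · have h1 := ncard_inter_Ici_anti ⟨B, hB⟩ (show (0 : ℤ) ≤ -((j : ℤ) - i) by omega)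
      have h2 : -((j : ℤ) - i) ≤ B := by
        by_contra h2
        have := hmain _ (not_le.1 h2)
        omega
      omega
  isLowerSet := by
    rintro ⟨i, j⟩ ⟨i', j'⟩ ⟨hi, hj⟩ hc
    simp only [Set.Finite.coe_toFinset, Set.mem_ofPred_eq] at hc ⊢
    dsimp only at hi hj
    have h1 := ncard_inter_Ici_anti hb (show (j' : ℤ) - i ≤ j - i by omega)
    have h2 := ncard_inter_Ici_le_add hb ((j' : ℤ) - i) (i - i')
    rw [show (j' : ℤ) - i + (i - i' : ℕ) = j' - i' by omega] at h2
    omega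

theorem mem_diagramOfMaya (hb : BddAbove S) (hS : ∀ x, x ∈ S ↔ -1 - x ∉ S) (i j : ℕ) :
    (i, j) ∈ diagramOfMaya hb hS ↔ i < (S ∩ Set.Ici ((j : ℤ) - i)).ncard := by
  rw [← YoungDiagram.mem_cells]
  simp [diagramOfMaya]

theorem rowLen_diagramOfMaya (hb : BddAbove S) (hS : ∀ x, x ∈ S ↔ -1 - x ∉ S) {x : ℤ}
    (hx : x ∈ S) :
    ((diagramOfMaya hb hS).rowLen (S ∩ Set.Ici (x + 1)).ncard : ℤ) =
      x + (S ∩ Set.Ici (x + 1)).ncard + 1 := by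
  classical
  have h1 := ncard_inter_Ici_succ hb x
  rw [if_pos hx] at h1
  -- This gives `x + i + 1 ≥ 0`, so the `toNat` below do not truncate.
  have h2 := ncard_inter_Ici_neg hb hS x
  set i := (S ∩ Set.Ici (x + 1)).ncard with hi
  apply le_antisymm
  · have h3 := YoungDiagram.mem_iff_lt_rowLen (μ := diagramOfMaya hb hS) (i := i)
      (j := (x + i + 1).toNat)
    rw [mem_diagramOfMaya, show (((x + i + 1).toNat : ℕ) : ℤ) - i = x + 1 by omega, ← hi] at h3
    omega
  · by_cases h0 : x + i + 1 = 0
    · omega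
    have h3 := YoungDiagram.mem_iff_lt_rowLen (μ := diagramOfMaya hb hS) (i := i)
      (j := (x + i).toNat)
    rw [mem_diagramOfMaya, show (((x + i).toNat : ℕ) : ℤ) - i = x by omega] at h3
    omega

/-- One inclusion suffices, since both sets are antisymmetric. -/
theorem maya_diagramOfMaya (hb : BddAbove S) (hS : ∀ x, x ∈ S ↔ -1 - x ∉ S) :
    (diagramOfMaya hb hS).maya = S := by
  have hsub : S ⊆ (diagramOfMaya hb hS).maya := by
    intro x hx
    refine ⟨(S ∩ Set.Ici (x + 1)).ncard, ?_⟩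
    dsimp only
    rw [rowLen_diagramOfMaya hb hS hx]
    ring
  have hself : (diagramOfMaya hb hS).IsSelfConjugate := by
    rw [YoungDiagram.IsSelfConjugate]
    ext ⟨i, j⟩
    rw [YoungDiagram.mem_cells, YoungDiagram.mem_cells, YoungDiagram.mem_transpose, Prod.swap_prod_mk,
      mem_diagramOfMaya, mem_diagramOfMaya]
    have := ncard_inter_Ici_neg hb hS ((j : ℤ) - i)
    rw [neg_sub] at this
    omega
  refine Set.Subset.antisymm (fun x hx => ?_) hsub
  by_contra hxS
  have h1 := ((YoungDiagram.isSelfConjugate_iff_maya _).1 hself x).1 hx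
  apply h1
  apply hsub
  rw [hS]
  simpa using hxS

end OfAntisymmetric

/-! ### Antisymmetric sets as regions below height functions -/

/-- Antisymmetric sets of integers closed under subtracting `s, s + d, …, s + p d`. -/
def antisymmetricSets (s d p : ℕ) : Set (Set ℤ) :=
  {S | (∀ x, x ∈ S ↔ -1 - x ∉ S) ∧ ∀ k ≤ p, ∀ x ∈ S, x - ((s + k * d : ℕ) : ℤ) ∈ S}

theorem bijOn_maya {s d p : ℕ} (hs : 0 < s) (hbdd : ∀ S ∈ antisymmetricSets s d p, BddAbove S) :
    Set.BijOn YoungDiagram.maya (selfConjugateCores s d p) (antisymmetricSets s d p) := by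
  have hiff : ∀ μ : YoungDiagram, μ ∈ selfConjugateCores s d p ↔
      μ.maya ∈ antisymmetricSets s d p := by
    intro μ
    simp only [selfConjugateCores, antisymmetricSets, Set.mem_ofPred_eq,
      YoungDiagram.isSelfConjugate_iff_maya]
    refine and_congr_right fun _ => forall_congr' fun k => imp_congr_right fun _ => ?_
    rw [YoungDiagram.isCore_iff_maya _ (by omega)]
  refine ⟨fun μ h => (hiff μ).1 h, YoungDiagram.maya_injective.injOn, fun S hS => ?_⟩
  have e := maya_diagramOfMaya (hbdd S hS) hS.1
  exact ⟨_, (hiff _).2 (e.symm ▸ hS), e⟩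


/-- Height functions of the columns of an antisymmetric set: integer paths with steps in
`{-1, 0, 1}`, no two consecutive up-steps, falling by `d` over each period `N`, and antisymmetric
about `-ε / 2`. -/
structure IsHeight (N ε d : ℤ) (h : ℤ → ℤ) : Prop where
  periodic : ∀ j, h (j + N) = h j - d
  symm : ∀ j, h j + h (-ε - j) = 0
  le_next : ∀ j, h j - 1 ≤ h (j + 1)
  le_prev : ∀ j, h j - 1 ≤ h (j - 1)
  le_prev_two : ∀ j, h j - 1 ≤ h (j - 2)

/-- The set of integers lying below the height function `h` in the coordinates
`x₀ + j d + i N`. -/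
def belowHeight (x₀ N d : ℤ) (h : ℤ → ℤ) : Set ℤ :=
  {x | ∃ j i, x = x₀ + j * d + i * N ∧ i ≤ h j}

section Height

variable {x₀ N ε d : ℤ} {h : ℤ → ℤ}

theorem add_mul_of_periodic (hper : ∀ j, h (j + N) = h j - d) (j k : ℤ) :
    h (j + k * N) = h j - k * d := by
  induction k using Int.induction_on with
  | zero => simp
  | succ k ih =>
    rw [show j + ((k : ℤ) + 1) * N = j + k * N + N by ring, hper, ih]
    ring
  | pred k ih =>
    have := hper (j + (-(k : ℤ) - 1) * N)
    rw [show j + (-(k : ℤ) - 1) * N + N = j + -(k : ℤ) * N by ring, ih] at this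
    linarith

/-- Coordinates are unique up to multiples of `(N, -d)`, and periodicity makes the condition
independent of the choice. -/
theorem mem_belowHeight_iff (hN : N ≠ 0) (hNd : IsCoprime N d)
    (hper : ∀ j, h (j + N) = h j - d) (j i : ℤ) :
    x₀ + j * d + i * N ∈ belowHeight x₀ N d h ↔ i ≤ h j := by
  constructor
  · rintro ⟨j', i', e, hi⟩
    have e2 : (j - j') * d = (i' - i) * N := by linarith
    obtain ⟨k, hk⟩ : N ∣ j - j' := hNd.dvd_of_dvd_mul_right ⟨i' - i, by rw [e2]; ring⟩
    have e3 : k * d = i' - i := by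
      apply mul_right_cancel₀ hN
      rw [← e2, hk]
      ring
    have := add_mul_of_periodic hper j' k
    rw [show j' + k * N = j by linarith] at this
    linarith
  · intro hi
    exact ⟨j, i, rfl, hi⟩

theorem exists_coords (hNd : IsCoprime N d) (x₀ x : ℤ) : ∃ j i, x = x₀ + j * d + i * N := by
  obtain ⟨u, v, e⟩ := hNd
  refine ⟨(x - x₀) * v, (x - x₀) * u, ?_⟩
  linear_combination (x₀ - x) * e

/-- The condition on `x₀` makes `x ↦ -1 - x` act as `(j, i) ↦ (-ε - j, 1 - i)`. -/
theorem IsHeight.belowHeight_mem {s d : ℕ} (hs : 0 < s) (hsd : Nat.Coprime s d)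
    (hx₀ : 2 * x₀ = ε * d - (s + d) - 1) (hh : IsHeight (s + d) ε d h) :
    belowHeight x₀ (s + d) d h ∈ antisymmetricSets s d 3 := by
  have hN : (s + d : ℤ) ≠ 0 := by positivity
  have hNd : IsCoprime (s + d : ℤ) d := by
    have := Nat.isCoprime_iff_coprime.2 hsd
    simpa using this.add_mul_right_left 1
  have hmem := mem_belowHeight_iff (x₀ := x₀) hN hNd hh.periodic
  constructor
  · intro x
    obtain ⟨j, i, rfl⟩ := exists_coords hNd x₀ x
    rw [show -1 - (x₀ + j * d + i * (s + d : ℤ)) = x₀ + (-ε - j) * d + (1 - i) * (s + d) by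
      linear_combination -hx₀, hmem, hmem]
    have := hh.symm j
    omega
  · intro k hk x
    obtain ⟨j, i, rfl⟩ := exists_coords hNd x₀ x
    rw [show x₀ + j * (d : ℤ) + i * (s + d : ℤ) - ((s + k * d : ℕ) : ℤ) =
      x₀ + (j + 1 - k) * d + (i - 1) * (s + d : ℤ) by push_cast; ring, hmem, hmem]
    intro hi
    interval_cases k
    · have := hh.le_next j
      simp only [Nat.cast_zero, sub_zero]
      omega
    · simp only [Nat.cast_one, add_sub_cancel_right]
      omega
    · have := hh.le_prev j
      rw [show j + 1 - ((2 : ℕ) : ℤ) = j - 1 by push_cast; ring]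
      omega
    · have := hh.le_prev_two j
      rw [show j + 1 - ((3 : ℕ) : ℤ) = j - 2 by push_cast; ring]
      omega

theorem exists_isHeight {s d : ℕ} (hs : 0 < s) (hsd : Nat.Coprime s d)
    (hx₀ : 2 * x₀ = ε * d - (s + d) - 1) {S : Set ℤ} (hS : S ∈ antisymmetricSets s d 3) :
    ∃ h, IsHeight (s + d) ε d h ∧ belowHeight x₀ (s + d) d h = S := by
  have hN : (s + d : ℤ) ≠ 0 := by positivity
  have hNd : IsCoprime (s + d : ℤ) d := by
    have := Nat.isCoprime_iff_coprime.2 hsd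
    simpa using this.add_mul_right_left 1
  obtain ⟨hsymm, hclosed⟩ := hS
  have hstep : ∀ k : ℕ, k ≤ 3 → ∀ j i : ℤ, x₀ + j * d + i * (s + d) ∈ S →
      x₀ + (j + 1 - k) * d + (i - 1) * (s + d : ℤ) ∈ S := by
    intro k hk j i hm
    have := hclosed k hk _ hm
    rwa [show x₀ + j * (d : ℤ) + i * (s + d : ℤ) - ((s + k * d : ℕ) : ℤ) =
      x₀ + (j + 1 - k) * d + (i - 1) * (s + d : ℤ) by push_cast; ring] at this
  have hdown : ∀ j i : ℤ, x₀ + j * d + i * (s + d) ∈ S → ∀ n : ℕ,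
      x₀ + j * d + (i - n) * (s + d) ∈ S := by
    intro j i hm n
    induction n with
    | zero => simpa using hm
    | succ n ih =>
      have := hstep 1 (by norm_num) _ _ ih
      push_cast at this ⊢
      rwa [add_sub_cancel_right, sub_sub] at this
  have hflip : ∀ j i : ℤ, x₀ + j * d + i * (s + d) ∈ S ↔
      x₀ + (-ε - j) * d + (1 - i) * (s + d) ∉ S := by
    intro j i
    rw [hsymm, show -1 - (x₀ + j * d + i * (s + d : ℤ)) = x₀ + (-ε - j) * d + (1 - i) * (s + d) by
      linear_combination -hx₀]
  -- `S` is nonempty, and the moves `k = 0` and `k = 2` carry a point into either adjacent column.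
  have hne : ∀ j : ℤ, ∃ i : ℤ, x₀ + j * d + i * (s + d) ∈ S := by
    obtain ⟨x, hx⟩ : ∃ x, x ∈ S := by
      by_cases h0 : (0 : ℤ) ∈ S
      · exact ⟨0, h0⟩
      · exact ⟨-1, by rw [hsymm]; simpa using h0⟩
    obtain ⟨j₀, i₀, rfl⟩ := exists_coords hNd x₀ x
    intro j
    induction j using Int.inductionOn' (b := j₀) with
    | zero => exact ⟨_, hx⟩
    | succ j _ ih =>
      obtain ⟨i, hi⟩ := ih
      have := hstep 0 (by norm_num) _ _ hi
      rw [Nat.cast_zero, sub_zero] at this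
      exact ⟨_, this⟩
    | pred j _ ih =>
      obtain ⟨i, hi⟩ := ih
      have := hstep 2 (by norm_num) _ _ hi
      rw [show j + 1 - ((2 : ℕ) : ℤ) = j - 1 by push_cast; ring] at this
      exact ⟨_, this⟩
  have hmax : ∀ j : ℤ, ∃ m : ℤ, ∀ i, x₀ + j * d + i * (s + d) ∈ S ↔ i ≤ m := by
    intro j
    have hle : ∀ i i', x₀ + j * d + i * (s + d) ∈ S → i' ≤ i → x₀ + j * d + i' * (s + d) ∈ S := by
      intro i i' hi hle
      have := hdown j i hi (i - i').toNat
      rwa [show i - ((i - i').toNat : ℤ) = i' by omega] at this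
    -- A point of the mirror column reflects to a missing point of column `j`, which bounds that
    -- column above.
    obtain ⟨b, hb⟩ := hne (-ε - j)
    rw [hflip, show -ε - (-ε - j) = j by ring] at hb
    obtain ⟨m, hm, hub⟩ := Int.exists_greatest_of_bdd
      (P := fun i => x₀ + j * d + i * (s + d) ∈ S) ⟨1 - b, fun i hi => by
        by_contra hlt
        exact hb (hle _ _ hi (by omega))⟩ (hne j)
    exact ⟨m, fun i => ⟨fun hi => hub i hi, fun hi => hle _ _ hm hi⟩⟩
  choose h hh using hmax
  have hext : ∀ a b : ℤ, (∀ i, i ≤ a ↔ i ≤ b) → a = b := fun a b hab =>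
    le_antisymm ((hab a).1 le_rfl) ((hab b).2 le_rfl)
  refine ⟨h, ⟨?_, ?_, ?_, ?_, ?_⟩, ?_⟩
  · intro j
    apply hext
    intro i
    rw [← hh, show x₀ + (j + (s + d)) * d + i * (s + d : ℤ) = x₀ + j * d + (i + d) * (s + d) by ring,
      hh]
    omega
  · intro j
    have : h j = - h (-ε - j) := by
      apply hext
      intro i
      rw [← hh, hflip, hh]
      omega
    omega
  · intro j
    have := hstep 0 (by norm_num) _ _ ((hh j _).2 le_rfl)
    rwa [Nat.cast_zero, sub_zero, hh] at this
  · intro j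
    have := hstep 2 (by norm_num) _ _ ((hh j _).2 le_rfl)
    rwa [show j + 1 - ((2 : ℕ) : ℤ) = j - 1 by push_cast; ring, hh] at this
  · intro j
    have := hstep 3 (by norm_num) _ _ ((hh j _).2 le_rfl)
    rwa [show j + 1 - ((3 : ℕ) : ℤ) = j - 2 by push_cast; ring, hh] at this
  · ext x
    constructor
    · rintro ⟨j, i, rfl, hi⟩
      exact (hh j i).2 hi
    · intro hx
      obtain ⟨j, i, rfl⟩ := exists_coords hNd x₀ x
      exact ⟨j, i, rfl, (hh j i).1 hx⟩

theorem IsHeight.bddAbove_belowHeight {s d : ℕ} (hs : 0 < s) (hh : IsHeight (s + d) ε d h) :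
    BddAbove (belowHeight x₀ (s + d) d h) := by
  have hle : ∀ n : ℕ, h n ≤ h 0 + n := by
    intro n
    induction n with
    | zero => simp
    | succ n ih =>
      have := hh.le_prev (n + 1)
      rw [add_sub_cancel_right] at this
      push_cast
      omega
  have hN : (0 : ℤ) < s + d := by positivity
  refine ⟨x₀ + (s + d) * d + (h 0 + (s + d)) * (s + d), ?_⟩
  rintro _ ⟨j, i, rfl, hi⟩
  have e := Int.emod_add_mul_ediv j (s + d)
  have h0 := Int.emod_nonneg j hN.ne'
  have h1 := Int.emod_lt_of_pos j hN
  generalize j % ((s : ℤ) + d) = r at e h0 h1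
  generalize j / ((s : ℤ) + d) = q at e
  have hp := add_mul_of_periodic hh.periodic r q
  rw [show r + q * (s + d : ℤ) = j by linarith] at hp
  have h2 := hle r.toNat
  rw [Int.toNat_of_nonneg h0] at h2
  have h3 : i + q * d ≤ h 0 + (s + d) := by linarith
  have h4 : (i + q * d) * (s + d) ≤ (h 0 + (s + d)) * (s + d) :=
    mul_le_mul_of_nonneg_right h3 hN.le
  have h5 : r * d ≤ (s + d) * d := mul_le_mul_of_nonneg_right h1.le (by positivity)
  rw [← e]
  linarith

theorem bijOn_belowHeight {s d : ℕ} (hs : 0 < s) (hsd : Nat.Coprime s d)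
    (hx₀ : 2 * x₀ = ε * d - (s + d) - 1) :
    Set.BijOn (belowHeight x₀ (s + d) d) {h | IsHeight (s + d) ε d h}
      (antisymmetricSets s d 3) := by
  refine ⟨fun h hh => IsHeight.belowHeight_mem hs hsd hx₀ hh, ?_, fun S hS => ?_⟩
  · intro h hh h' hh' e
    have hN : (s + d : ℤ) ≠ 0 := by positivity
    have hNd : IsCoprime (s + d : ℤ) d := by
      have := Nat.isCoprime_iff_coprime.2 hsd
      simpa using this.add_mul_right_left 1
    funext j
    have h1 := mem_belowHeight_iff (x₀ := x₀) hN hNd hh.periodic j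
    have h2 := mem_belowHeight_iff (x₀ := x₀) hN hNd hh'.periodic j
    simp only [e] at h1
    exact le_antisymm ((h2 _).1 ((h1 _).2 le_rfl)) ((h1 _).1 ((h2 _).2 le_rfl))
  · exact exists_isHeight hs hsd hx₀ hS

end Height


/-! ### Height functions as words of steps -/

/-- `IsWord M ε d (l, z)`: the letters of `l` (of which there are `M`) and `z` are the steps of a
path, none of them an up-step following an up-step (with a fictitious initial up-step when `ε = 0`),
such that the path doubled around the last step `z` falls by `d`. -/
structure IsWord (M : ℕ) (ε d : ℤ) (w : List ℤ × ℤ) : Prop where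
  length_eq : w.1.length = M
  letters : ∀ x ∈ w.1 ++ [w.2], -1 ≤ x ∧ x ≤ 1
  chain : List.IsChain (fun x y : ℤ => ¬(x = 1 ∧ y = 1)) ((1 - ε) :: (w.1 ++ [w.2]))
  sum_eq : 2 * w.1.sum + w.2 = -d

/-- The first steps of an integer path. -/
def stepWord (M : ℕ) (h : ℤ → ℤ) : List ℤ × ℤ :=
  ((List.range M).map fun k : ℕ => h (k + 1) - h k, h (M + 1) - h M)

theorem isChain_cons_map_range {α : Type*} {R : α → α → Prop} (p : α) (g : ℕ → α) (M : ℕ) :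
    List.IsChain R (p :: (List.range (M + 1)).map g) ↔
      R p (g 0) ∧ ∀ i < M, R (g i) (g (i + 1)) := by
  rw [List.isChain_iff_getElem]
  constructor
  · intro h
    refine ⟨?_, fun i hi => ?_⟩
    · simpa using h 0 (by simp)
    · have := h (i + 1) (by simpa using hi)
      rw [List.getElem_cons_succ] at this
      simpa using this
  · rintro ⟨h0, h1⟩ i hi
    rcases i with _ | i
    · simpa using h0
    · rw [List.getElem_cons_succ]
      simpa using h1 i (by simpa using hi)

theorem sum_map_range_sub (h : ℤ → ℤ) (M : ℕ) :
    ((List.range M).map fun k : ℕ => h (k + 1) - h k).sum = h M - h 0 := by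
  induction M with
  | zero => simp
  | succ M ih =>
    rw [List.range_succ, List.map_append, List.sum_append, ih]
    simp

section StepWord

variable {N ε d : ℤ} {M : ℕ} {h : ℤ → ℤ}

/-- For `ε = 1` the step from `-1` to `0` equals `2 * h 0`, yet has absolute value at most 1. -/
theorem IsHeight.apply_zero (hε : ε = 0 ∨ ε = 1) (hh : IsHeight N ε d h) : h 0 = 0 := by
  have h1 := hh.symm 0
  have h2 := hh.le_prev 0
  have h3 := hh.le_next (-1)
  rcases hε with rfl | rfl
  · norm_num at h1
    omega
  · norm_num at h1 h2 h3
    omega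

theorem IsHeight.isWord_stepWord (hε : ε = 0 ∨ ε = 1) (hN : N = 2 * M + 1 + ε)
    (hh : IsHeight N ε d h) : IsWord M ε d (stepWord M h) := by
  have hz := hh.apply_zero hε
  have e : (stepWord M h).1 ++ [(stepWord M h).2] =
      (List.range (M + 1)).map fun k : ℕ => h (k + 1) - h k := by
    simp [stepWord, List.range_succ]
  refine ⟨by simp [stepWord], ?_, ?_, ?_⟩
  · rw [e]
    intro x hx
    obtain ⟨k, -, rfl⟩ := List.mem_map.1 hx
    have h1 := hh.le_next k
    have h2 := hh.le_prev (k + 1)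
    rw [add_sub_cancel_right] at h2
    omega
  · rw [e, isChain_cons_map_range]
    constructor
    -- For `ε = 0`, `h 1 - h (-1) = 2 * h 1` is at most 1, so the first step is not up.
    · rcases hε with rfl | rfl
      · have h1 := hh.symm 1
        have h2 := hh.le_prev_two 1
        norm_num at h1 h2 ⊢
        omega
      · simp
    · intro i _
      have h1 := hh.le_prev_two (i + 1 + 1)
      rw [show (i : ℤ) + 1 + 1 - 2 = i by ring] at h1
      push_cast
      omega
  · simp only [stepWord]
    rw [sum_map_range_sub, hz]
    -- `M` reflects to `-ε - M = M + 1 - N`, whence `h M + h (M + 1) = -d`.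
    have h1 := hh.symm M
    have h2 := hh.periodic (-ε - M)
    rw [hN, show -ε - (M : ℤ) + (2 * M + 1 + ε) = M + 1 by ring] at h2
    linarith

theorem IsHeight.eq_of_stepWord_eq (hε : ε = 0 ∨ ε = 1) (hN : N = 2 * M + 1 + ε) {h' : ℤ → ℤ}
    (hh : IsHeight N ε d h) (hh' : IsHeight N ε d h') (e : stepWord M h = stepWord M h') :
    h = h' := by
  have hlast : h (M + 1) - h M = h' (M + 1) - h' M := congrArg Prod.snd e
  have hinit : ∀ k : ℕ, k < M → h (k + 1) - h k = h' (k + 1) - h' k := by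
    have := congrArg Prod.fst e
    simp only [stepWord, List.map_inj_left, List.mem_range] at this
    exact this
  have hsmall : ∀ k : ℕ, k ≤ M + 1 → h k = h' k := by
    intro k
    induction k with
    | zero =>
      intro _
      have h1 := hh.apply_zero hε
      have h2 := hh'.apply_zero hε
      push_cast
      omega
    | succ k ih =>
      intro hk
      have h1 := ih (by omega)
      have h2 : h (k + 1) - h k = h' (k + 1) - h' k := by
        rcases Nat.lt_or_ge k M with hlt | hge
        · exact hinit k hlt
        · rw [show k = M by omega]
          exact hlast
      push_cast
      omega
  have hper : ∀ r : ℤ, 0 ≤ r → r < N → h r = h' r := by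
    intro r h0 h1
    rcases le_or_gt r (M + 1) with hr | hr
    -- The values up to `M + 1` are known; a larger `r` goes to `2 * M + 1 - r` under reflection
    -- followed by one period.
    · have := hsmall r.toNat (by omega)
      rwa [Int.toNat_of_nonneg h0] at this
    · have e1 := hh.symm r
      have e2 := hh'.symm r
      have e3 := hh.periodic (-ε - r)
      have e4 := hh'.periodic (-ε - r)
      have e5 := hsmall (-ε - r + N).toNat (by omega)
      rw [Int.toNat_of_nonneg (by omega)] at e5
      omega
  have hNpos : 0 < N := by omega
  funext j
  rw [← Int.emod_add_mul_ediv j N, mul_comm, add_mul_of_periodic hh.periodic,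
    add_mul_of_periodic hh'.periodic,
    hper _ (Int.emod_nonneg j hNpos.ne') (Int.emod_lt_of_pos j hNpos)]

/-- The steps `a 0, …, a M` unfolded to a full period. -/
def unfoldStep (M : ℕ) (a : ℕ → ℤ) (r : ℕ) : ℤ :=
  -- Within a period, the final 0 is used only at `r = 2 * M + 1` with `ε = 1`: the step from `-1`
  -- to `0`.
  if r ≤ M then a r else if r ≤ 2 * M then a (2 * M - r) else 0

theorem sum_unfoldStep (a : ℕ → ℤ) (M : ℕ) :
    ∑ i ∈ Finset.range (2 * M + 1), unfoldStep M a i =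
      2 * (∑ i ∈ Finset.range M, a i) + a M := by
  have hle : ∀ j ≤ M + 1, ∑ i ∈ Finset.range j, unfoldStep M a i = ∑ i ∈ Finset.range j, a i := by
    intro j hj
    refine Finset.sum_congr rfl fun i hi => ?_
    have := Finset.mem_range.1 hi
    rw [unfoldStep, if_pos (by omega)]
  have key : ∀ j ≤ M, ∑ i ∈ Finset.range (M + 1 + j), unfoldStep M a i +
      ∑ i ∈ Finset.range (M - j), a i = 2 * (∑ i ∈ Finset.range M, a i) + a M := by
    intro j
    induction j with
    | zero =>
      intro _
      rw [add_zero, hle _ le_rfl, Finset.sum_range_succ]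
      simp only [Nat.sub_zero]
      ring
    | succ j ih =>
      intro hj
      rw [← ih (by omega), ← add_assoc, Finset.sum_range_succ,
        show M - j = M - (j + 1) + 1 by omega, Finset.sum_range_succ _ (M - (j + 1)), unfoldStep,
        if_neg (by omega), if_pos (by omega), show 2 * M - (M + 1 + j) = M - (j + 1) by omega]
      ring
  have := key M le_rfl
  rwa [Nat.sub_self, Finset.sum_range_zero, add_zero, show M + 1 + M = 2 * M + 1 by ring] at this

/-- The periodic extension of the unfolded steps. -/
def periodicStep (M : ℕ) (N : ℤ) (a : ℕ → ℤ) (k : ℤ) : ℤ :=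
  unfoldStep M a (k % N).toNat

/-- The path with given first steps. -/
def unfoldPath (M : ℕ) (N d : ℤ) (a : ℕ → ℤ) (k : ℤ) : ℤ :=
  ∑ i ∈ Finset.range (k % N).toNat, unfoldStep M a i - k / N * d

theorem periodicStep_add_mul {a : ℕ → ℤ} {r : ℕ} (hr : (r : ℤ) < N) (q : ℤ) :
    periodicStep M N a (r + q * N) = unfoldStep M a r := by
  rw [periodicStep, Int.add_mul_emod_self_right, Int.emod_eq_of_lt (by omega) hr, Int.toNat_natCast]

theorem exists_nat_add_mul (hN : 0 < N) (k : ℤ) : ∃ (r : ℕ) (q : ℤ), (r : ℤ) < N ∧ k = r + q * N := by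
  have h0 := Int.emod_nonneg k hN.ne'
  refine ⟨(k % N).toNat, k / N, ?_, ?_⟩
  · have := Int.emod_lt_of_pos k hN
    omega
  · rw [Int.toNat_of_nonneg h0, mul_comm, Int.emod_add_mul_ediv]

theorem unfoldPath_add_mul {a : ℕ → ℤ} {r : ℕ} (hr : (r : ℤ) < N) (q : ℤ) :
    unfoldPath M N d a (r + q * N) = ∑ i ∈ Finset.range r, unfoldStep M a i - q * d := by
  rw [unfoldPath, Int.add_mul_emod_self_right, Int.emod_eq_of_lt (by omega) hr, Int.toNat_natCast,
    Int.add_mul_ediv_right _ _ (by omega), Int.ediv_eq_zero_of_lt (by omega) hr, zero_add]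

theorem unfoldPath_succ (hε : ε = 0 ∨ ε = 1) (hN : N = 2 * M + 1 + ε) {a : ℕ → ℤ}
    (ha : 2 * (∑ i ∈ Finset.range M, a i) + a M = -d) (k : ℤ) :
    unfoldPath M N d a (k + 1) = unfoldPath M N d a k + periodicStep M N a k := by
  obtain ⟨r, q, hr, rfl⟩ := exists_nat_add_mul (show 0 < N by omega) k
  rw [periodicStep_add_mul hr, unfoldPath_add_mul hr]
  rcases lt_or_ge ((r : ℤ) + 1) N with hlt | hge
  · rw [show (r : ℤ) + q * N + 1 = (r + 1 : ℕ) + q * N by push_cast; ring,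
      unfoldPath_add_mul (by push_cast; exact hlt), Finset.sum_range_succ]
    ring
  · have hrN : (r : ℤ) + 1 = N := by omega
    rw [show (r : ℤ) + q * N + 1 = (0 : ℕ) + (q + 1) * N by push_cast; linarith,
      unfoldPath_add_mul (by push_cast; omega), Finset.sum_range_zero]
    have hfull : ∑ i ∈ Finset.range (r + 1), unfoldStep M a i = -d := by
      rw [← ha, ← sum_unfoldStep]
      rcases hε with rfl | rfl
      · rw [show r + 1 = 2 * M + 1 by omega]
      · rw [show r + 1 = 2 * M + 1 + 1 by omega, Finset.sum_range_succ _ (2 * M + 1),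
          unfoldStep, if_neg (by omega), if_neg (by omega), add_zero]
    rw [Finset.sum_range_succ] at hfull
    linarith

/-- Modulo `N` this is the reflection `r ↦ 2 * M - r` about the last free step; for `ε = 1` it also
fixes the class of `2 * M + 1`. -/
theorem periodicStep_symm (hε : ε = 0 ∨ ε = 1) (hN : N = 2 * M + 1 + ε) (a : ℕ → ℤ) (k : ℤ) :
    periodicStep M N a (-1 - ε - k) = periodicStep M N a k := by
  obtain ⟨r, q, hr, rfl⟩ := exists_nat_add_mul (show 0 < N by omega) k
  rw [periodicStep_add_mul hr]
  rcases Nat.lt_or_ge (2 * M) r with hlt | hge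
  · have hr' : (r : ℤ) = 2 * M + 1 := by omega
    have hε1 : ε = 1 := by omega
    rw [show -1 - ε - ((r : ℤ) + q * N) = r + (-q - 2) * N by
      rw [hN, hr', hε1]; ring, periodicStep_add_mul hr]
  · rw [show -1 - ε - ((r : ℤ) + q * N) = (2 * M - r : ℕ) + (-q - 1) * N by
      rw [hN, Nat.cast_sub hge]; push_cast; ring, periodicStep_add_mul (by omega)]
    simp only [unfoldStep]
    split_ifs <;> first | rfl | omega | (congr 1; omega)

theorem isHeight_unfoldPath (hε : ε = 0 ∨ ε = 1) (hN : N = 2 * M + 1 + ε) {a : ℕ → ℤ}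
    (hsum : 2 * (∑ i ∈ Finset.range M, a i) + a M = -d)
    (hle : ∀ i ≤ M, -1 ≤ a i ∧ a i ≤ 1) (hzero : ε = 0 → a 0 ≠ 1)
    (hchain : ∀ i < M, ¬(a i = 1 ∧ a (i + 1) = 1)) :
    IsHeight N ε d (unfoldPath M N d a) := by
  have hNpos : 0 < N := by omega
  have hstep := unfoldPath_succ hε hN hsum
  have hG : ∀ r, -1 ≤ unfoldStep M a r ∧ unfoldStep M a r ≤ 1 := by
    intro r
    simp only [unfoldStep]
    split_ifs
    · exact hle _ (by assumption)
    · exact hle _ (by omega)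
    · norm_num
  have hg : ∀ k, -1 ≤ periodicStep M N a k ∧ periodicStep M N a k ≤ 1 := fun k => hG _
  have hgg : ∀ k, ¬(periodicStep M N a k = 1 ∧ periodicStep M N a (k + 1) = 1) := by
    intro k
    obtain ⟨r, q, hr, rfl⟩ := exists_nat_add_mul hNpos k
    rw [periodicStep_add_mul hr]
    rcases lt_or_ge ((r : ℤ) + 1) N with hlt | hge
    · rw [show (r : ℤ) + q * N + 1 = (r + 1 : ℕ) + q * N by push_cast; ring,
        periodicStep_add_mul (by push_cast; exact hlt)]
      rcases Nat.lt_or_ge r M with h1 | h1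
      · rw [unfoldStep, if_pos h1.le, unfoldStep, if_pos (by omega)]
        exact hchain r h1
      rcases Nat.lt_or_ge r (2 * M) with h2 | h2
      · have h3 := hchain (2 * M - (r + 1)) (by omega)
        rw [show 2 * M - (r + 1) + 1 = 2 * M - r by omega] at h3
        have h4 : unfoldStep M a (r + 1) = a (2 * M - (r + 1)) := by
          rw [unfoldStep, if_neg (by omega), if_pos (by omega)]
        have h5 : unfoldStep M a r = a (2 * M - r) := by
          rw [unfoldStep]
          split_ifs
          · rw [show 2 * M - r = r by omega]
          · rfl
          · omega
        rw [h4, h5]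
        tauto
      · have h4 : unfoldStep M a (r + 1) = 0 := by
          rw [unfoldStep, if_neg (by omega), if_neg (by omega)]
        rw [h4]
        norm_num
    · rw [show (r : ℤ) + q * N + 1 = (0 : ℕ) + (q + 1) * N by push_cast; linarith,
        periodicStep_add_mul (by push_cast; omega)]
      -- At the seam between periods, for `ε = 0` the next step is `a 0`, which is not up; for `ε =
      -- 1` the step before the seam is 0.
      rcases hε with rfl | rfl
      · have h4 : unfoldStep M a 0 = a 0 := by rw [unfoldStep, if_pos (by omega)]
        rw [h4]
        exact fun h => hzero rfl h.2
      · have h4 : unfoldStep M a r = 0 := by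
          rw [unfoldStep, if_neg (by omega), if_neg (by omega)]
        rw [h4]
        norm_num
  refine ⟨?_, ?_, ?_, ?_, ?_⟩
  · intro j
    obtain ⟨r, q, hr, rfl⟩ := exists_nat_add_mul hNpos j
    rw [show (r : ℤ) + q * N + N = r + (q + 1) * N by ring, unfoldPath_add_mul hr,
      unfoldPath_add_mul hr]
    ring
  -- Mirror steps are equal, so `h j + h (-ε - j)` is constant in `j`; it vanishes at `j = 0`.
  · have hmove : ∀ j, unfoldPath M N d a (j + 1) + unfoldPath M N d a (-ε - (j + 1)) =
        unfoldPath M N d a j + unfoldPath M N d a (-ε - j) := by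
      intro j
      have h1 := hstep j
      have h2 := hstep (-ε - (j + 1))
      have h3 := periodicStep_symm hε hN a j
      rw [show -ε - (j + 1) + 1 = -ε - j by ring] at h2
      rw [show -1 - ε - j = -ε - (j + 1) by ring] at h3
      linarith
    have h0 : unfoldPath M N d a 0 = 0 := by simp [unfoldPath]
    intro j
    induction j using Int.induction_on with
    | zero =>
      rcases hε with rfl | rfl
      · simp [h0]
      · have h1 := hstep (-1)
        have h2 := periodicStep_add_mul (M := M) (a := a) (N := N) (r := 2 * M + 1)
          (by push_cast; omega) (-1)
        rw [unfoldStep, if_neg (by omega), if_neg (by omega),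
          show ((2 * M + 1 : ℕ) : ℤ) + -1 * N = -1 by push_cast; omega] at h2
        norm_num at h1 ⊢
        omega
    | succ j ih => rw [hmove, ih]
    | pred j ih =>
      have := hmove (-(j : ℤ) - 1)
      rw [sub_add_cancel] at this
      rw [← this, ih]
  · intro j
    have h1 := hstep j
    have h2 := hg j
    omega
  · intro j
    have h1 := hstep (j - 1)
    have h2 := hg (j - 1)
    rw [sub_add_cancel] at h1
    omega
  · intro j
    have h1 := hstep (j - 2)
    have h2 := hstep (j - 1)
    have h3 := hg (j - 2)
    have h4 := hg (j - 1)
    have h5 := hgg (j - 2)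
    rw [sub_add_cancel] at h2
    rw [show j - 2 + 1 = j - 1 by ring] at h1 h5
    omega

theorem exists_stepWord_eq (hε : ε = 0 ∨ ε = 1) (hN : N = 2 * M + 1 + ε) {w : List ℤ × ℤ}
    (hw : IsWord M ε d w) : ∃ h, IsHeight N ε d h ∧ stepWord M h = w := by
  obtain ⟨l, z⟩ := w
  obtain ⟨hlen, hlet, hchain, hsum⟩ := hw
  dsimp only at hlen hlet hchain hsum
  obtain ⟨a, ha⟩ : ∃ a : ℕ → ℤ, l ++ [z] = (List.range (M + 1)).map a := by
    refine ⟨fun i => (l ++ [z]).getD i 0, List.ext_getElem (by simp [hlen]) fun i h1 h2 => ?_⟩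
    rw [List.getElem_map, List.getElem_range, List.getD_eq_getElem _ _ h1]
  have ha' := ha
  rw [List.range_succ, List.map_append, List.map_singleton] at ha'
  obtain ⟨hl, hz⟩ := List.append_inj' ha' rfl
  rw [List.singleton_inj] at hz
  rw [ha, isChain_cons_map_range] at hchain
  rw [ha] at hlet
  have hsum' : 2 * (∑ i ∈ Finset.range M, a i) + a M = -d := by
    rw [← hsum, hl, hz]
    rfl
  have hH := isHeight_unfoldPath hε hN hsum'
    (fun i hi => hlet _ (List.mem_map.2 ⟨i, List.mem_range.2 (by omega), rfl⟩))
    (fun h0 h1 => hchain.1 ⟨by omega, h1⟩) hchain.2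
  refine ⟨_, hH, ?_⟩
  have hstep : ∀ k : ℕ, k ≤ M →
      unfoldPath M N d a (k + 1) - unfoldPath M N d a k = a k := by
    intro k hk
    have h1 := periodicStep_add_mul (M := M) (a := a) (N := N) (r := k) (by omega) 0
    rw [zero_mul, add_zero, unfoldStep, if_pos hk] at h1
    rw [unfoldPath_succ hε hN hsum', h1]
    ring
  rw [stepWord, hstep M le_rfl, ← hz, hl]
  congr 1
  exact List.map_congr_left fun k hk => hstep k (List.mem_range.1 hk).le

theorem bijOn_stepWord (hε : ε = 0 ∨ ε = 1) (hN : N = 2 * M + 1 + ε) :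
    Set.BijOn (stepWord M) {h | IsHeight N ε d h} {w | IsWord M ε d w} :=
  ⟨fun _ hh => IsHeight.isWord_stepWord hε hN hh,
    fun _ hh _ hh' e => IsHeight.eq_of_stepWord_eq hε hN hh hh' e,
    fun _ hw => exists_stepWord_eq hε hN hw⟩

end StepWord


/-! ### Counting words without adjacent up-steps -/

/-- Lists with `u` letters `1`, `f` letters `0` and `e` letters `-1` in which, after prepending `p`
and appending `z`, no letter `1` follows a letter `1`. -/
def stepLists (p z : ℤ) (u f e : ℕ) : Set (List ℤ) :=
  {l | (∀ x ∈ l, -1 ≤ x ∧ x ≤ 1) ∧ List.IsChain (fun x y : ℤ => ¬(x = 1 ∧ y = 1)) (p :: (l ++ [z])) ∧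
    l.count 1 = u ∧ l.count 0 = f ∧ l.count (-1) = e}

theorem nil_mem_stepLists {p z : ℤ} {u f e : ℕ} :
    [] ∈ stepLists p z u f e ↔ ¬(p = 1 ∧ z = 1) ∧ u = 0 ∧ f = 0 ∧ e = 0 := by
  simp [stepLists, eq_comm]

theorem cons_mem_stepLists {p z x : ℤ} {l : List ℤ} {u f e : ℕ} :
    x :: l ∈ stepLists p z u f e ↔
      (x = 0 ∧ 0 < f ∧ l ∈ stepLists 0 z u (f - 1) e) ∨
      (x = -1 ∧ 0 < e ∧ l ∈ stepLists (-1) z u f (e - 1)) ∨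
      (x = 1 ∧ (p ≠ 1 ∧ 0 < u) ∧ l ∈ stepLists 1 z (u - 1) f e) := by
  simp only [stepLists, Set.mem_ofPred_eq, List.mem_cons, forall_eq_or_imp, List.cons_append,
    List.isChain_cons_cons, List.count_cons, beq_iff_eq]
  constructor
  · rintro ⟨⟨⟨h1, h2⟩, h3⟩, ⟨h4, h5⟩, h6, h7, h8⟩
    obtain rfl | rfl | rfl : x = 0 ∨ x = -1 ∨ x = 1 := by omega
    · norm_num at h6 h7 h8
      exact Or.inl ⟨rfl, by omega, h3, h5, by omega, by omega, by omega⟩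
    · norm_num at h6 h7 h8
      exact Or.inr (Or.inl ⟨rfl, by omega, h3, h5, by omega, by omega, by omega⟩)
    · norm_num at h6 h7 h8
      exact Or.inr (Or.inr ⟨rfl, ⟨by tauto, by omega⟩, h3, h5, by omega, by omega, by omega⟩)
  · rintro (⟨rfl, hf, h3, h5, h6, h7, h8⟩ | ⟨rfl, hf, h3, h5, h6, h7, h8⟩ |
      ⟨rfl, ⟨hp, hf⟩, h3, h5, h6, h7, h8⟩)
    · refine ⟨⟨by norm_num, h3⟩, ⟨by norm_num, h5⟩, ?_⟩
      norm_num
      omega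
    · refine ⟨⟨by norm_num, h3⟩, ⟨by norm_num, h5⟩, ?_⟩
      norm_num
      omega
    · refine ⟨⟨by norm_num, h3⟩, ⟨fun h => hp h.1, h5⟩, ?_⟩
      norm_num
      omega

theorem encard_ite {α : Type*} (P : Prop) [Decidable P] (s : Set α) :
    (if P then s else ∅ : Set α).encard = if P then s.encard else 0 := by
  split_ifs <;> simp

theorem encard_stepLists_rec (p z : ℤ) (u f e : ℕ) :
    (stepLists p z u f e).encard =
      (if ¬(p = 1 ∧ z = 1) ∧ u = 0 ∧ f = 0 ∧ e = 0 then 1 else 0) +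
      ((if 0 < f then (stepLists 0 z u (f - 1) e).encard else 0) +
      ((if 0 < e then (stepLists (-1) z u f (e - 1)).encard else 0) +
      (if p ≠ 1 ∧ 0 < u then (stepLists 1 z (u - 1) f e).encard else 0))) := by
  have hset : stepLists p z u f e =
      (if ¬(p = 1 ∧ z = 1) ∧ u = 0 ∧ f = 0 ∧ e = 0 then {[]} else ∅) ∪
      ((List.cons 0 '' if 0 < f then stepLists 0 z u (f - 1) e else ∅) ∪
      ((List.cons (-1) '' if 0 < e then stepLists (-1) z u f (e - 1) else ∅) ∪
      (List.cons 1 '' if p ≠ 1 ∧ 0 < u then stepLists 1 z (u - 1) f e else ∅))) := by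
    ext l
    rcases l with _ | ⟨x, l⟩
    · rw [nil_mem_stepLists]
      simp
    · rw [cons_mem_stepLists]
      simp [Set.mem_ite_empty_right, and_left_comm, eq_comm]
  have hinj : ∀ x : ℤ, Function.Injective (List.cons x) := fun x => List.cons_injective
  rw [hset, Set.encard_union_eq, Set.encard_union_eq, Set.encard_union_eq, (hinj _).encard_image,
    (hinj _).encard_image, (hinj _).encard_image, encard_ite, encard_ite, encard_ite, encard_ite,
    Set.encard_singleton]
  · rw [Set.disjoint_left]
    rintro _ ⟨l, -, rfl⟩ ⟨l', -, h⟩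
    simp at h
  · rw [Set.disjoint_left]
    rintro _ ⟨l, -, rfl⟩ (⟨l', -, h⟩ | ⟨l', -, h⟩) <;> simp at h
  · rw [Set.disjoint_left]
    intro l h1
    have : l = [] := by
      split_ifs at h1
      · exact h1
      · exact h1.elim
    subst this
    rintro (⟨l', -, h⟩ | ⟨l', -, h⟩ | ⟨l', -, h⟩) <;> simp at h

/-- The number of lists in `stepLists`, where `b` counts the boundary letters equal to `1`. -/
def stepCount (b n f u : ℕ) : ℕ :=
  -- For `n = 0` and `b = 2` the only gap is blocked from both sides, but truncated subtraction
  -- would give 1 at `u = 0`.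
  if n + 1 < b then 0 else n.choose f * (n + 1 - b).choose u

/-- The recursion after a boundary up-step: the first letter, if any, is 0 or -1. It is Pascal's
rule in `f`. -/
theorem stepCount_add_one (c f e u : ℕ) (hc : c ≤ 1) :
    stepCount (1 + c) (f + e) f u = (if c = 0 ∧ u = 0 ∧ f = 0 ∧ e = 0 then 1 else 0) +
      ((if 0 < f then stepCount c (f - 1 + e) (f - 1) u else 0) +
      (if 0 < e then stepCount c (f + (e - 1)) f u else 0)) := by
  rcases f with _ | f <;> rcases e with _ | e
  · interval_cases c
    · rcases u with _ | u <;> simp [stepCount]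
    · simp [stepCount]
  · interval_cases c <;> simp [stepCount]
  · interval_cases c <;> simp [stepCount]
  · simp only [stepCount, Nat.add_sub_cancel, Nat.succ_pos, if_true]
    rw [if_neg (by omega), if_neg (by omega), if_neg (by omega), if_neg (by omega),
      show f + (e + 1) = f + e + 1 by ring, show f + 1 + e = f + e + 1 by ring,
      show f + 1 + (e + 1) = f + e + 1 + 1 by ring, Nat.choose_succ_succ (f + e + 1) f,
      show f + e + 1 + 1 + 1 - (1 + c) = f + e + 1 + 1 - c by omega]
    ring

/-- Pascal's rule in `u`: the freed first gap is either empty or holds an up-step. The extra 1 is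
the empty word, which is lost when both boundary letters are up-steps. -/
theorem stepCount_pascal (c f e u : ℕ) (hc : c ≤ 1) :
    stepCount c (f + e) f u = (if c ≠ 0 ∧ u = 0 ∧ f = 0 ∧ e = 0 then 1 else 0) +
      (stepCount (1 + c) (f + e) f u +
      (if 0 < u then stepCount (1 + c) (f + e) f (u - 1) else 0)) := by
  by_cases h0 : f + e = 0
  · obtain ⟨rfl, rfl⟩ : f = 0 ∧ e = 0 := by omega
    interval_cases c
    · rcases u with _ | _ | u <;> simp [stepCount, Nat.choose_eq_zero_of_lt]
    · rcases u with _ | u <;> simp [stepCount]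
  · rw [if_neg (by omega), zero_add]
    simp only [stepCount]
    rw [if_neg (by omega), if_neg (by omega), show f + e + 1 - (1 + c) = f + e - c by omega,
      show f + e + 1 - c = f + e - c + 1 by omega]
    rcases u with _ | u
    · simp
    · rw [if_pos (Nat.succ_pos _), if_neg (by omega), Nat.choose_succ_succ, Nat.succ_sub_one]
      ring

/-- The `f + e` letters other than 1 are arranged freely and leave `f + e + 1` gaps, each holding at
most one up-step; a boundary letter 1 blocks the gap next to it. -/
theorem encard_stepLists (p z : ℤ) (u f e : ℕ) :
    (stepLists p z u f e).encard =
      stepCount ((if p = 1 then 1 else 0) + if z = 1 then 1 else 0) (f + e) f u := by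
  induction hm : u + f + e using Nat.strong_induction_on generalizing p u f e with
  | _ m ih =>
  set c := if z = 1 then 1 else 0 with hcdef
  have hc : c ≤ 1 := by rw [hcdef]; split_ifs <;> norm_num
  have hz : z = 1 ↔ c ≠ 0 := by rw [hcdef]; split_ifs <;> simp_all
  have h1 : (if 0 < f then (stepLists 0 z u (f - 1) e).encard else 0) =
      ((if 0 < f then stepCount c (f - 1 + e) (f - 1) u else 0 : ℕ) : ℕ∞) := by
    split_ifs with h
    · rw [ih _ (by omega) 0 u (f - 1) e rfl, if_neg (by norm_num), zero_add]
    · rfl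
  have h2 : (if 0 < e then (stepLists (-1) z u f (e - 1)).encard else 0) =
      ((if 0 < e then stepCount c (f + (e - 1)) f u else 0 : ℕ) : ℕ∞) := by
    split_ifs with h
    · rw [ih _ (by omega) (-1) u f (e - 1) rfl, if_neg (by norm_num), zero_add]
    · rfl
  have h3 : (if p ≠ 1 ∧ 0 < u then (stepLists 1 z (u - 1) f e).encard else 0) =
      ((if p ≠ 1 ∧ 0 < u then stepCount (1 + c) (f + e) f (u - 1) else 0 : ℕ) : ℕ∞) := by
    split_ifs with h
    · rw [ih _ (by omega) 1 (u - 1) f e rfl, if_pos rfl]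
    · rfl
  have h4 := stepCount_add_one c f e u hc
  rw [encard_stepLists_rec, h1, h2, h3]
  by_cases hp : p = 1
  · rw [if_pos hp, h4]
    simp [hp, hz]
  · rw [if_neg hp, zero_add, stepCount_pascal c f e u hc, h4]
    norm_cast
    by_cases hcz : c = 0
    · simp [hp, hcz, add_assoc]
    · simp [hp, hcz, add_assoc]

theorem length_eq_counts {l : List ℤ} (hl : ∀ x ∈ l, -1 ≤ x ∧ x ≤ 1) :
    l.length = l.count 1 + l.count 0 + l.count (-1) ∧
      l.sum = (l.count 1 : ℤ) - l.count (-1) := by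
  induction l with
  | nil => simp
  | cons x l ih =>
    obtain ⟨h1, h2⟩ := ih fun y hy => hl y (List.mem_cons_of_mem _ hy)
    have h3 := hl x List.mem_cons_self
    rw [List.length_cons, List.sum_cons, List.count_cons, List.count_cons, List.count_cons, h1, h2]
    obtain rfl | rfl | rfl : x = 0 ∨ x = -1 ∨ x = 1 := by omega
    all_goals
      norm_num
      try omega

/-! ### Summing over up-steps and last letters -/

/-- Length and sum determine the numbers of letters 0 and -1 from `u` and `z`. -/
theorem encard_words_fiber {M u f e : ℕ} {ε d z : ℤ} (hz : -1 ≤ z ∧ z ≤ 1)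
    (hd : 2 * (u : ℤ) - 2 * e + z = -d) (hM : u + f + e = M) :
    {w | IsWord M ε d w ∧ w.1.count 1 = u ∧ w.2 = z}.encard =
      (stepLists (1 - ε) z u f e).encard := by
  rw [← Function.Injective.encard_image (f := fun l : List ℤ => (l, z))
    (fun a b h => (Prod.ext_iff.1 h).1)]
  congr 1
  ext ⟨l, z'⟩
  simp only [Set.mem_ofPred_eq, Set.mem_image, Prod.mk.injEq]
  constructor
  · rintro ⟨⟨h1, h2, h3, h4⟩, h5, rfl⟩
    dsimp only at h1 h2 h3 h4
    have hl : ∀ x ∈ l, -1 ≤ x ∧ x ≤ 1 := fun x hx => h2 x (List.mem_append_left _ hx)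
    obtain ⟨h6, h7⟩ := length_eq_counts hl
    exact ⟨l, ⟨hl, h3, h5, by omega, by omega⟩, rfl, rfl⟩
  · rintro ⟨l, ⟨h1, h2, h3, h4, h5⟩, rfl, rfl⟩
    obtain ⟨h6, h7⟩ := length_eq_counts h1
    refine ⟨⟨by dsimp only; omega, fun x hx => ?_, h2, by dsimp only; omega⟩, h3, rfl⟩
    rcases List.mem_append.1 hx with h | h
    · exact h1 x h
    · rw [List.mem_singleton.1 h]
      exact hz

theorem encard_eq_sum_fiber {α : Type*} (W : Set α) (key : α → ℕ) (K : ℕ)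
    (hK : ∀ w ∈ W, key w < K) :
    W.encard = ∑ i ∈ Finset.range K, {w | w ∈ W ∧ key w = i}.encard := by
  induction K generalizing W with
  | zero =>
    rw [Finset.sum_range_zero, Set.encard_eq_zero]
    exact Set.eq_empty_of_forall_notMem fun w hw => Nat.not_lt_zero _ (hK w hw)
  | succ K ih =>
    have hW : W = {w | w ∈ W ∧ key w < K} ∪ {w | w ∈ W ∧ key w = K} := by
      ext w
      simp only [Set.mem_union, Set.mem_ofPred_eq]
      constructor
      · intro hw
        have := hK w hw
        rcases Nat.lt_succ_iff_lt_or_eq.1 this with h | h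
        · exact Or.inl ⟨hw, h⟩
        · exact Or.inr ⟨hw, h⟩
      · rintro (h | h) <;> exact h.1
    rw [Finset.sum_range_succ]
    conv_lhs => rw [hW]
    rw [Set.encard_union_eq, ih _ fun w hw => hw.2]
    · congr 1
      refine Finset.sum_congr rfl fun i hi => ?_
      congr 1
      ext w
      have := Finset.mem_range.1 hi
      simp only [Set.mem_ofPred_eq]
      constructor
      · rintro ⟨⟨h1, -⟩, h3⟩
        exact ⟨h1, h3⟩
      · rintro ⟨h1, h3⟩
        exact ⟨⟨h1, by omega⟩, h3⟩
    · rw [Set.disjoint_left]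
      rintro w ⟨-, h1⟩ ⟨-, h2⟩
      omega

/-- Parity forces the last letter to be 0. With `i` up-steps there are `m - 2 * i` zeros and `i + D`
down-steps, and only the first gap is blocked. -/
theorem encard_words_of_even (m D : ℕ) :
    {w | IsWord (m + D) 0 (2 * D) w}.encard =
      ∑ i ∈ Finset.range (m / 2 + 1), (((m + D - i).choose (m - 2 * i) *
        (m + D - i).choose i : ℕ) : ℕ∞) := by
  have hkey : ∀ w : List ℤ × ℤ, IsWord (m + D) 0 (2 * D) w →
      w.2 = 0 ∧ w.1.count 1 < m / 2 + 1 := by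
    rintro ⟨l, z⟩ ⟨h1, h2, h3, h4⟩
    dsimp only at h1 h2 h3 h4 ⊢
    have hz := h2 z (by simp)
    obtain ⟨h6, h7⟩ := length_eq_counts fun x hx => h2 x (List.mem_append_left _ hx)
    omega
  rw [encard_eq_sum_fiber {w | IsWord _ _ _ w} (fun w => w.1.count 1) _ fun w hw => (hkey w hw).2]
  refine Finset.sum_congr rfl fun i hi => ?_
  have hi' := Finset.mem_range.1 hi
  have e : {w : List ℤ × ℤ | w ∈ {w | IsWord (m + D) 0 (2 * D) w} ∧ w.1.count 1 = i} =
      {w | IsWord (m + D) 0 (2 * D) w ∧ w.1.count 1 = i ∧ w.2 = 0} := by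
    ext w
    simp only [Set.mem_ofPred_eq]
    exact ⟨fun h => ⟨h.1, h.2, (hkey w h.1).1⟩, fun h => ⟨h.1, h.2.1⟩⟩
  rw [e, encard_words_fiber (f := m - 2 * i) (e := i + D) (by norm_num) (by push_cast; ring)
    (by omega), encard_stepLists, if_pos (by norm_num), if_neg (by norm_num), stepCount,
    if_neg (by omega), show m - 2 * i + (i + D) = m + D - i by omega]
  simp

/-- Parity forces the last letter to be 1 or -1. The index is `i = 2 * u + [z = 1]`, and the word
has `m - i` zeros before its last letter. -/
theorem encard_words_of_odd {ε : ℕ} (hε : ε ≤ 1) (m D : ℕ) :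
    {w | IsWord (m + D) ε (2 * D + 1) w}.encard =
      ∑ i ∈ Finset.range (m + 1), (((m + D - i / 2).choose (m - i) *
        (m + D + ε - (i + 1) / 2).choose (i / 2) : ℕ) : ℕ∞) := by
  have hkey : ∀ w : List ℤ × ℤ, IsWord (m + D) ε (2 * D + 1) w →
      (w.2 = -1 ∨ w.2 = 1) ∧ 2 * w.1.count 1 + (if w.2 = 1 then 1 else 0) < m + 1 := by
    rintro ⟨l, z⟩ ⟨h1, h2, h3, h4⟩
    dsimp only at h1 h2 h3 h4 ⊢
    have hz := h2 z (by simp)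
    obtain ⟨h6, h7⟩ := length_eq_counts fun x hx => h2 x (List.mem_append_left _ hx)
    split_ifs <;> omega
  rw [encard_eq_sum_fiber {w | IsWord _ _ _ w} (fun w => 2 * w.1.count 1 + (if w.2 = 1 then 1 else 0)) _
    fun w hw => (hkey w hw).2]
  refine Finset.sum_congr rfl fun i hi => ?_
  have hi' := Finset.mem_range.1 hi
  obtain ⟨u, hu⟩ := Nat.even_or_odd' i
  have hp : (if (1 : ℤ) - ε = 1 then 1 else 0) = 1 - ε := by
    interval_cases ε <;> norm_num
  rcases hu with rfl | rfl
  · have e : {w : List ℤ × ℤ | w ∈ {w | IsWord (m + D) ε (2 * D + 1) w} ∧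
          2 * w.1.count 1 + (if w.2 = 1 then 1 else 0) = 2 * u} =
        {w | IsWord (m + D) ε (2 * D + 1) w ∧ w.1.count 1 = u ∧ w.2 = -1} := by
      ext w
      simp only [Set.mem_ofPred_eq]
      refine and_congr_right fun hw => ?_
      have := (hkey w hw).1
      split_ifs <;> omega
    rw [e, encard_words_fiber (f := m - 2 * u) (e := u + D) (by norm_num) (by push_cast; ring)
      (by omega), encard_stepLists, hp, if_neg (by norm_num), stepCount,
      if_neg (by omega), show m - 2 * u + (u + D) = m + D - u by omega,
      show 2 * u / 2 = u by omega, show (2 * u + 1) / 2 = u by omega,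
      show m + D - u + 1 - (1 - ε + 0) = m + D + ε - u by omega]
  · have e : {w : List ℤ × ℤ | w ∈ {w | IsWord (m + D) ε (2 * D + 1) w} ∧
          2 * w.1.count 1 + (if w.2 = 1 then 1 else 0) = 2 * u + 1} =
        {w | IsWord (m + D) ε (2 * D + 1) w ∧ w.1.count 1 = u ∧ w.2 = 1} := by
      ext w
      simp only [Set.mem_ofPred_eq]
      refine and_congr_right fun hw => ?_
      have := (hkey w hw).1
      split_ifs <;> omega
    rw [e, encard_words_fiber (f := m - (2 * u + 1)) (e := u + D + 1) (by norm_num)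
      (by push_cast; ring) (by omega), encard_stepLists, hp, if_pos rfl, stepCount,
      if_neg (by omega), show m - (2 * u + 1) + (u + D + 1) = m + D - u by omega,
      show (2 * u + 1) / 2 = u by omega, show (2 * u + 1 + 1) / 2 = u + 1 by omega,
      show m + D - u + 1 - (1 - ε + 1) = m + D + ε - (u + 1) by omega]

/-! ### Assembling the bijections -/

theorem encard_selfConjugateCores {s d M : ℕ} {ε x₀ : ℤ} (hs : 0 < s) (hsd : Nat.Coprime s d)
    (hε : ε = 0 ∨ ε = 1) (hM : (s + d : ℤ) = 2 * M + 1 + ε)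
    (hx₀ : 2 * x₀ = ε * d - (s + d) - 1) :
    (selfConjugateCores s d 3).encard = {w | IsWord M ε d w}.encard := by
  have h1 := bijOn_belowHeight hs hsd hx₀
  have h2 := bijOn_maya (s := s) (d := d) (p := 3) hs fun S hS => by
    obtain ⟨h, hh, rfl⟩ := h1.surjOn hS
    exact IsHeight.bddAbove_belowHeight hs hh
  rw [Set.encard_congr h2.equiv, ← Set.encard_congr h1.equiv,
    Set.encard_congr (bijOn_stepWord hε hM).equiv]

theorem encard_selfConjugateCores_of_even {s d : ℕ} (hs : 0 < s) (hsd : Nat.Coprime s d)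
    (hd : Even d) :
    (selfConjugateCores s d 3).encard = ((∑ i ∈ Finset.range (s / 4 + 1),
      ((s + d - 1) / 2 - i).choose ((s - 1) / 2 - 2 * i) * ((s + d - 1) / 2 - i).choose i : ℕ) :
        ℕ∞) := by
  obtain ⟨D, rfl⟩ := hd
  have hodd : ¬ 2 ∣ s := fun h => by
    have := Nat.dvd_gcd h (⟨D, by ring⟩ : 2 ∣ D + D)
    rw [hsd.gcd_eq_one] at this
    omega
  obtain ⟨m, rfl⟩ : ∃ m, s = 2 * m + 1 := ⟨s / 2, by omega⟩
  rw [encard_selfConjugateCores (M := m + D) (ε := 0) (x₀ := -(m + D) - 1) hs hsd (Or.inl rfl)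
    (by push_cast; ring) (by push_cast; ring), show ((D + D : ℕ) : ℤ) = 2 * D by push_cast; ring,
    encard_words_of_even, show (2 * m + 1) / 4 = m / 2 by omega,
    show (2 * m + 1 + (D + D) - 1) / 2 = m + D by omega, show (2 * m + 1 - 1) / 2 = m by omega]
  push_cast
  rfl

theorem encard_selfConjugateCores_of_odd {s d : ℕ} (hs : 0 < s) (hsd : Nat.Coprime s d)
    (hd : Odd d) :
    (selfConjugateCores s d 3).encard = ((∑ i ∈ Finset.range (s / 2 + 1),
      ((s + d - 1) / 2 - i / 2).choose (s / 2 - i) *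
        ((s + d) / 2 - (i + 1) / 2).choose (i / 2) : ℕ) : ℕ∞) := by
  obtain ⟨D, rfl⟩ := hd
  -- Here `ε` is the parity of `s`, so that `s + d = 2 * (m + D) + 1 + ε`.
  obtain ⟨m, ε, hε, rfl⟩ : ∃ m ε : ℕ, ε ≤ 1 ∧ s = 2 * m + ε := ⟨s / 2, s % 2, by omega, by omega⟩
  have hx₀ : ∃ x₀ : ℤ, 2 * x₀ =
      (ε : ℤ) * (2 * D + 1 : ℕ) - ((2 * m + ε : ℕ) + (2 * D + 1 : ℕ)) - 1 :=
    ⟨ε * D - m - D - 1, by push_cast; ring⟩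
  obtain ⟨x₀, hx₀⟩ := hx₀
  rw [encard_selfConjugateCores (M := m + D) (ε := ε) (x₀ := x₀) hs hsd (by omega)
    (by push_cast; ring) hx₀,
    show ((2 * D + 1 : ℕ) : ℤ) = 2 * D + 1 by push_cast; ring,
    encard_words_of_odd hε, show (2 * m + ε) / 2 = m by omega,
    show (2 * m + ε + (2 * D + 1) - 1) / 2 = m + D by omega,
    show (2 * m + ε + (2 * D + 1)) / 2 = m + D + ε by omega]
  push_cast
  rfl

theorem theorem3p3 (s d : ℕ) (hs : 0 < s) (hd : 0 < d) (hsd : Nat.Coprime s d) :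
    (selfConjugateCores s d 3).Finite ∧
    (Even d → (selfConjugateCores s d 3).ncard =
      ∑ i ∈ Finset.range (s / 4 + 1),
        ((s + d - 1) / 2 - i).choose ((s - 1) / 2 - 2 * i) * ((s + d - 1) / 2 - i).choose i) ∧
    (Odd d → (selfConjugateCores s d 3).ncard =
      ∑ i ∈ Finset.range (s / 2 + 1),
        ((s + d - 1) / 2 - i / 2).choose (s / 2 - i) *
          ((s + d) / 2 - (i + 1) / 2).choose (i / 2)) := by
  refine ⟨?_, fun h => ?_, fun h => ?_⟩
  · rcases Nat.even_or_odd d with h | h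
    · exact Set.finite_of_encard_eq_coe (encard_selfConjugateCores_of_even hs hsd h)
    · exact Set.finite_of_encard_eq_coe (encard_selfConjugateCores_of_odd hs hsd h)
  · rw [Set.ncard, encard_selfConjugateCores_of_even hs hsd h, ENat.toNat_natCast]
  · rw [Set.ncard, encard_selfConjugateCores_of_odd hs hsd h, ENat.toNat_natCast]
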